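/- Let $\mathbb D=\{z\in\mathbb C:|z|<1\}$. Let $1<\alpha\le \tfrac32$, let $n\ge 1$ be an integer, and let $\lambda\in\mathbb C$ with $|\lambda|\le \frac1{n+1}$. Denote by $\mathcal F(\alpha,\lambda,n)$ the class of all harmonic mappings $f=h+\overline g$ of $\mathbb D$, where $h$ and $g$ are analytic in $\mathbb D$ with $h(0)=0$, $h'(0)=1$, $g(0)=0$, such that $h'$ has no zero in $\mathbb D$ and, for all $z\in\mathbb D$, $$\operatorname{Re}\left(1+\frac{zh''(z)}{h'(z)}\right)<\alpha\qquad\text{and}\qquad g'(z)=\lambda z^n h'(z).$$ For $0<r<1$ let $\mathbb D_r=\{z\in\mathbb C:|z|<r\}$, and let $\mathcal A(f(\mathbb D_r))$ denote the area (Lebesgue measure) of the image set $f(\mathbb D_r)$. Then for every $f\in\mathcal F(\alpha,\lambda,n)$ and every $0<r<1$, $$2\pi\int_0^r\left(1-|\lambda|^2\xi^{2n}\right)(1-\xi)^2\,\xi\,d\xi\;\le\;\mathcal A(f(\mathbb D_r))\;\le\;2\pi\int_0^r\left(1-|\lambda|^2\xi^{2n}\right)(1+\xi)^2\,\xi\,d\xi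 .$$ -/

import Mathlib

open Metric MeasureTheory

/-- `f = h + conj g` on the open unit disk, where `h` and `g` are analytic in the disk with
`h(z) = z + ∑_{k ≥ 2} a_k z^k` and `g(z) = ∑_{k ≥ 1} b_k z^k`. This says that `f` is a harmonic
function on the disk with `f(0) = 0` and `f_z(0) = 1`, and that `h` and `g` are its analytic and
co-analytic parts. -/
structure IsNormalizedHarmonic (f h g : ℂ → ℂ) : Prop where
  analytic_h : AnalyticOnNhd ℂ h (ball 0 1)
  analytic_g : AnalyticOnNhd ℂ g (ball 0 1)
  eq_add_conj : ∀ z ∈ ball (0 : ℂ) 1, f z = h z + (starRingEnd ℂ) (g z)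
  h_zero : h 0 = 0
  deriv_h_zero : deriv h 0 = 1
  g_zero : g 0 = 0

/-- The class `F(α, lam, n)`: normalized harmonic mappings `f = h + conj g` of the unit disk with
`Re (1 + z h''(z) / h'(z)) < α` and `g'(z) = lam z ^ n h'(z)` on the disk. The quotient is meant as
a genuine one, so `h'` has no zero in the disk. -/
def harmonicClassF (α : ℝ) (lam : ℂ) (n : ℕ) : Set (ℂ → ℂ) :=
  {f | ∃ h g : ℂ → ℂ, IsNormalizedHarmonic f h g ∧
    (∀ z ∈ ball (0 : ℂ) 1,
      deriv h z ≠ 0 ∧ (1 + z * deriv (deriv h) z / deriv h z).re < α) ∧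
    (∀ z ∈ ball (0 : ℂ) 1, deriv g z = lam * z ^ n * deriv h z)}

/-!
The area of `f(D_r)` is the integral of the Jacobian `|h'|² - |g'|² = (1 - |λ|²|z|²ⁿ)|h'|²` over
`D_r`, provided that `f` is injective. So two things are needed: the distortion bound
`1 - |z| ≤ |h'(z)| ≤ 1 + |z|`, and the injectivity of `f`.

*Distortion.* Since `α ≤ 3/2`, the function `p = h'` satisfies `Re (z p'/p) < 1/2`. If `|p - 1| < 1`
failed somewhere in the disk, then at a point of smallest modulus with `|p - 1| = 1` Jack's lemma
(`exists_one_le_mul_deriv_eq`) gives `z p' = k (p - 1)` with `k ≥ 1`, whereas `|p - 1| = 1` means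
`Re ((p - 1)/p) = 1/2`; this is a contradiction. The Schwarz lemma improves `|p - 1| < 1` to
`|p(z) - 1| ≤ |z|` (`norm_sub_one_le`), which contains the distortion bound and also `Re h' > 0`.

*Injectivity.* If `f z = f w`, then `|h z - h w| = |g z - g w|`, so `h + ε g` takes the same value at
`z` and `w` for some `|ε| = 1`. Hence it suffices that every `F = h + ε g` is injective. Now
`F' = h' φ'` with `φ(z) = z + a zⁿ⁺¹`, `a = ε λ / (n + 1)`, `(n + 1)² |a| ≤ 1`. The map `φ` is
injective with convex image (`polyMap_image_convex`), and `F ∘ φ⁻¹` has derivative `h' ∘ φ⁻¹`, of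
positive real part, on this convex set, so it is injective by the Noshiro–Warschawski criterion: `F`
is close-to-convex with respect to `φ`.

*Convexity of the image of `φ`.* It follows from a supporting line at every boundary point `φ(w)`,
`|w| = 1`: with `m = n + 1`, `ζ = z / w`, `b = a wⁿ` and `S = 1 + ζ + ⋯ + ζᵐ⁻¹`,
`(φ(w) - φ(z)) / (w φ'(w)) = (1 - ζ) - (1 - ζ) b (m - S) / (1 + m b)`, and the estimate
`|m - S| ≤ m (m - 1) |1 - ζ| / 2` bounds the real part below by
`Re (1 - ζ) - |1 - ζ|² / 2 = (1 - |ζ|²) / 2`.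
-/

/-! ### Jack's lemma and the distortion bound -/

lemma norm_le_of_norm_lt_of_norm_lt {ω : ℂ → ℂ} (hω : ContinuousOn ω (ball 0 1)) {z₀ : ℂ}
    (hz₀ : ‖z₀‖ < 1) (hz0 : z₀ ≠ 0) (hlt : ∀ z, ‖z‖ < ‖z₀‖ → ‖ω z‖ < 1) :
    ∀ z, ‖z‖ ≤ ‖z₀‖ → ‖ω z‖ ≤ 1 := by
  have hR : ‖z₀‖ ≠ 0 := norm_ne_zero_iff.2 hz0
  have hm : Set.MapsTo ω (ball 0 ‖z₀‖) (closedBall 0 1) := fun z hz => by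
    simpa using (hlt z (by simpa using hz)).le
  have := hm.closure_of_continuousOn
    (hω.mono (by rw [closure_ball _ hR]; exact closedBall_subset_ball hz₀))
  rw [closure_ball _ hR, isClosed_closedBall.closure_eq] at this
  intro z hz
  simpa using this (by simpa using hz)

/-- **Jack's lemma.** The tangential derivative of `Re (conj (ω z₀) * ω z)` at `z₀` vanishes, so the
factor is real; by the Schwarz lemma this quantity is at most `t` at `z = t z₀`, with equality at
`t = 1`, so the factor is at least `1`. -/
lemma exists_one_le_mul_deriv_eq {ω : ℂ → ℂ} (hω : DifferentiableOn ℂ ω (ball 0 1))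
    (h0 : ω 0 = 0) {z₀ : ℂ} (hz₀ : ‖z₀‖ < 1) (hlt : ∀ z, ‖z‖ < ‖z₀‖ → ‖ω z‖ < 1) (h1 : ‖ω z₀‖ = 1) :
    ∃ k : ℝ, 1 ≤ k ∧ z₀ * deriv ω z₀ = k * ω z₀ := by
  have hz0 : z₀ ≠ 0 := by
    rintro rfl
    simp [h0] at h1
  have hR : 0 < ‖z₀‖ := norm_pos_iff.2 hz0
  have hd : HasDerivAt ω (deriv ω z₀) z₀ :=
    (hω.differentiableAt (isOpen_ball.mem_nhds (by simpa using hz₀))).hasDerivAt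
  have hsub : closedBall (0 : ℂ) ‖z₀‖ ⊆ ball 0 1 := closedBall_subset_ball hz₀
  have hle := norm_le_of_norm_lt_of_norm_lt hω.continuousOn hz₀ hz0 hlt
  have hschwarz : ∀ z, ‖z‖ < ‖z₀‖ → ‖ω z‖ ≤ ‖z‖ / ‖z₀‖ := by
    intro z hz
    have := Complex.dist_le_div_mul_dist_of_mapsTo_ball (f := ω) (c := 0) (R₁ := ‖z₀‖) (R₂ := 1)
      (z := z) (hω.mono (ball_subset_closedBall.trans hsub))
      (fun w hw => by simpa [h0] using (hlt w (by simpa using hw)).le) (by simpa using hz)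
    simpa [h0, div_eq_inv_mul] using this
  set e : ℂ := (starRingEnd ℂ) (ω z₀) with he
  have hee : e * ω z₀ = 1 := by
    rw [he, mul_comm, Complex.mul_conj, Complex.normSq_eq_norm_sq, h1]; simp
  have hen : ‖e‖ = 1 := by rw [he, RCLike.norm_conj, h1]
  set c : ℂ := e * (z₀ * deriv ω z₀) with hc
  have hreb : ∀ w, (e * w).re ≤ ‖w‖ := fun w =>
    (Complex.re_le_norm _).trans (by rw [norm_mul, hen, one_mul])
  -- Tangential direction: `θ ↦ z₀ e^{iθ}` stays on the circle, where `‖ω‖ ≤ 1`.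
  have him : c.im = 0 := by
    have hcurve : HasDerivAt (fun θ : ℝ => z₀ * Complex.exp (θ * Complex.I))
        (z₀ * Complex.I) 0 := by
      have h := (((Complex.ofRealCLM.hasDerivAt (x := (0 : ℝ))).mul_const
        Complex.I).cexp).const_mul z₀
      simpa using h
    have h2 : HasDerivAt (fun θ : ℝ => e * ω (z₀ * Complex.exp (θ * Complex.I)))
        (e * (deriv ω z₀ * (z₀ * Complex.I))) 0 := by
      refine HasDerivAt.const_mul e (HasDerivAt.comp (h₂ := ω) (0 : ℝ) ?_ hcurve)
      simpa using hd
    have h3 : HasDerivAt (fun θ : ℝ => (e * ω (z₀ * Complex.exp (θ * Complex.I))).re)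
        (e * (deriv ω z₀ * (z₀ * Complex.I))).re 0 :=
      (Complex.reCLM.hasFDerivAt.comp_hasDerivAt (0 : ℝ) h2)
    have hmax : IsLocalMax (fun θ : ℝ => (e * ω (z₀ * Complex.exp (θ * Complex.I))).re) 0 := by
      refine Filter.Eventually.of_forall fun θ => ?_
      simp only [Complex.ofReal_zero, zero_mul, Complex.exp_zero, mul_one, hee, Complex.one_re]
      refine (hreb _).trans (hle _ ?_)
      simp [Complex.norm_exp_ofReal_mul_I]
    have h4 := hmax.hasDerivAt_eq_zero h3
    have h5 : e * (deriv ω z₀ * (z₀ * Complex.I)) = c * Complex.I := by rw [hc]; ring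
    rw [h5] at h4
    simpa using h4
  -- Radial direction: only `t ≤ 1` is available, so the maximum at `t = 1` is one-sided.
  have hre : 1 ≤ c.re := by
    have hcurve : HasDerivAt (fun t : ℝ => (t : ℂ) * z₀) z₀ 1 := by
      simpa using (Complex.ofRealCLM.hasDerivAt (x := (1 : ℝ))).mul_const z₀
    have h2 : HasDerivAt (fun t : ℝ => e * ω (t * z₀)) (e * (deriv ω z₀ * z₀)) 1 := by
      refine HasDerivAt.const_mul e (HasDerivAt.comp (h₂ := ω) (1 : ℝ) ?_ hcurve)
      simpa using hd
    have h3 : HasDerivAt (fun t : ℝ => (e * ω (t * z₀)).re - t)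
        ((e * (deriv ω z₀ * z₀)).re - 1) 1 :=
      (Complex.reCLM.hasFDerivAt.comp_hasDerivAt (1 : ℝ) h2).sub (hasDerivAt_id _)
    have hmax : IsLocalMaxOn (fun t : ℝ => (e * ω (t * z₀)).re - t) (Set.Icc 0 1) 1 := by
      refine IsMaxOn.localize fun t ht => ?_
      simp only [Complex.ofReal_one, one_mul, hee, Complex.one_re, Set.mem_ofPred_eq, sub_self]
      rcases ht.2.eq_or_lt with rfl | h
      · simp [hee]
      · have hn : ‖(t : ℂ) * z₀‖ = t * ‖z₀‖ := by
          rw [norm_mul, Complex.norm_real, Real.norm_of_nonneg ht.1]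
        have h6 := hschwarz (t * z₀) (by rw [hn]; nlinarith)
        rw [hn, mul_div_assoc, div_self hR.ne', mul_one] at h6
        linarith [hreb (ω (t * z₀))]
    have h4 := hmax.hasFDerivWithinAt_nonpos h3.hasFDerivAt.hasFDerivWithinAt (y := 0 - 1)
      (sub_mem_posTangentConeAt_of_segment_subset (by rw [segment_symm, segment_eq_Icc zero_le_one]))
    have h5 : e * (deriv ω z₀ * z₀) = c := by rw [hc]; ring
    rw [h5] at h4
    simp at h4
    linarith
  refine ⟨c.re, hre, ?_⟩
  have hcr : (c.re : ℂ) = c := by apply Complex.ext <;> simp [him]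
  rw [hcr, hc]
  linear_combination (-(z₀ * deriv ω z₀)) * hee

/-- In the language of subordination: if `Re (z p' / p) < 1 / 2`, then `p ≺ 1 - z`. -/
lemma norm_sub_one_le {p : ℂ → ℂ} (hp : DifferentiableOn ℂ p (ball 0 1)) (h0 : p 0 = 1)
    (hne : ∀ z ∈ ball (0 : ℂ) 1, p z ≠ 0)
    (hre : ∀ z ∈ ball (0 : ℂ) 1, (z * deriv p z / p z).re < 1 / 2) :
    ∀ z ∈ ball (0 : ℂ) 1, ‖p z - 1‖ ≤ ‖z‖ := by
  have hω : DifferentiableOn ℂ (fun z => p z - 1) (ball 0 1) := hp.sub_const 1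
  have hlt : ∀ z ∈ ball (0 : ℂ) 1, ‖p z - 1‖ < 1 := by
    by_contra! hcon
    obtain ⟨w, hw, hw1⟩ := hcon
    have hsub : closedBall (0 : ℂ) ‖w‖ ⊆ ball 0 1 := closedBall_subset_ball (by simpa using hw)
    have hcpt : IsCompact (closedBall (0 : ℂ) ‖w‖ ∩ (fun z => ‖p z - 1‖) ⁻¹' Set.Ici 1) :=
      (isCompact_closedBall _ _).of_isClosed_subset
        ((hω.continuousOn.mono hsub).norm.preimage_isClosed_of_isClosed isClosed_closedBall
          isClosed_Ici) Set.inter_subset_left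
    obtain ⟨z₀, ⟨hz₀w, hz₀1⟩, hmin⟩ := hcpt.exists_isMinOn ⟨w, by simp, hw1⟩
      continuous_norm.continuousOn
    have hz₀ : z₀ ∈ ball (0 : ℂ) 1 := hsub hz₀w
    have hsmall : ∀ z, ‖z‖ < ‖z₀‖ → ‖p z - 1‖ < 1 := by
      intro z hz
      by_contra! h
      have h2 : ‖z₀‖ ≤ ‖z‖ := hmin ⟨by
        simp only [mem_closedBall, dist_zero_right] at hz₀w ⊢
        linarith, h⟩
      linarith
    have heq : ‖p z₀ - 1‖ = 1 := by
      refine le_antisymm ?_ hz₀1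
      have hz0 : z₀ ≠ 0 := by
        rintro rfl
        simp [h0] at hz₀1
        linarith
      exact norm_le_of_norm_lt_of_norm_lt hω.continuousOn (by simpa using hz₀) hz0 hsmall z₀ le_rfl
    obtain ⟨k, hk, hkeq⟩ := exists_one_le_mul_deriv_eq hω (by simp [h0]) (by simpa using hz₀)
      hsmall heq
    rw [deriv_sub_const] at hkeq
    have h1 := hre z₀ hz₀
    -- The Möbius map `ω ↦ ω / (1 + ω)` sends the unit circle to the line `Re = 1 / 2`.
    have h2 : (2 : ℝ) * ((p z₀ - 1) / p z₀).re = 1 := by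
      have hns : Complex.normSq (p z₀ - 1) = 1 := by
        rw [Complex.normSq_eq_norm_sq, heq]; simp
      have hnp : Complex.normSq (p z₀) ≠ 0 := by simpa using hne z₀ hz₀
      rw [Complex.div_re]
      rw [Complex.normSq_apply] at hns
      rw [Complex.normSq_apply] at hnp ⊢
      simp only [Complex.sub_re, Complex.one_re, Complex.sub_im, Complex.one_im] at hns ⊢
      rw [← add_div, ← mul_div_assoc, div_eq_one_iff_eq hnp]
      linarith
    rw [hkeq, mul_div_assoc, Complex.re_ofReal_mul] at h1
    nlinarith
  intro z hz
  have := Complex.dist_le_div_mul_dist_of_mapsTo_ball (f := fun z => p z - 1) (c := 0) (R₁ := 1)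
    (R₂ := 1) (z := z) hω (fun w hw => by simpa [h0] using (hlt w hw).le) hz
  simpa [h0] using this

/-! ### Convexity of the image of `z + a z ^ (n + 1)` -/

lemma norm_geom_sum_sub_le {z : ℂ} (hz : ‖z‖ ≤ 1) (m : ℕ) :
    ‖(m : ℂ) - ∑ k ∈ Finset.range m, z ^ k‖ ≤ m * (m - 1) / 2 * ‖1 - z‖ := by
  have hpow : ∀ k : ℕ, ‖1 - z ^ k‖ ≤ k * ‖1 - z‖ := by
    intro k
    rw [← mul_neg_geom_sum, norm_mul, mul_comm]
    gcongr
    refine (norm_sum_le _ _).trans ?_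
    calc ∑ i ∈ Finset.range k, ‖z ^ i‖ ≤ ∑ i ∈ Finset.range k, (1 : ℝ) :=
          Finset.sum_le_sum fun i _ => by rw [norm_pow]; exact pow_le_one₀ (norm_nonneg _) hz
      _ = k := by simp
  induction m with
  | zero => simp
  | succ m ih =>
    rw [Finset.sum_range_succ]
    have : ((m + 1 : ℕ) : ℂ) - (∑ k ∈ Finset.range m, z ^ k + z ^ m) =
        ((m : ℂ) - ∑ k ∈ Finset.range m, z ^ k) + (1 - z ^ m) := by push_cast; ring
    rw [this]
    refine (norm_add_le _ _).trans ((add_le_add ih (hpow m)).trans (le_of_eq ?_))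
    push_cast; ring

lemma norm_pow_sub_pow_le {z w : ℂ} (hz : ‖z‖ ≤ 1) (hw : ‖w‖ ≤ 1) (m : ℕ) :
    ‖z ^ m - w ^ m‖ ≤ m * ‖z - w‖ := by
  induction m with
  | zero => simp
  | succ m ih =>
    have : z ^ (m + 1) - w ^ (m + 1) = z * (z ^ m - w ^ m) + (z - w) * w ^ m := by ring
    rw [this]
    refine (norm_add_le _ _).trans ?_
    rw [norm_mul, norm_mul, norm_pow]
    have h1 : ‖w‖ ^ m ≤ 1 := pow_le_one₀ (norm_nonneg _) hw
    have h2 : ‖z‖ * ‖z ^ m - w ^ m‖ ≤ 1 * (m * ‖z - w‖) := by gcongr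
    have h3 : ‖z - w‖ * ‖w‖ ^ m ≤ ‖z - w‖ * 1 := by gcongr
    push_cast
    linarith

/-- The supporting-line inequality for the image of `ζ ↦ ζ + b ζ ^ m` at the boundary point `1`. -/
lemma re_div_pos_of_one {b ζ : ℂ} {m : ℕ} (hm : 2 ≤ m) (hb : (m : ℝ) ^ 2 * ‖b‖ ≤ 1)
    (hζ : ‖ζ‖ < 1) :
    0 < ((1 - ζ + b * (1 - ζ ^ m)) / (1 + m * b)).re := by
  have hm' : (2 : ℝ) ≤ m := by exact_mod_cast hm
  set S := ∑ k ∈ Finset.range m, ζ ^ k with hS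
  have hgeom : 1 - ζ ^ m = (1 - ζ) * S := (mul_neg_geom_sum ζ m).symm
  have hden : 1 - m * ‖b‖ ≤ ‖1 + m * b‖ := by
    have := norm_sub_norm_le (1 : ℂ) (-(m * b))
    simpa using this
  have hmb : m * ‖b‖ ≤ 1 / 2 := by nlinarith [norm_nonneg b]
  have hpos : 0 < ‖1 + m * b‖ := by linarith
  have hne : 1 + m * b ≠ 0 := norm_pos_iff.1 hpos
  have hkey : (1 - ζ + b * (1 - ζ ^ m)) / (1 + m * b) =
      (1 - ζ) - (1 - ζ) * (b * (m - S)) / (1 + m * b) := by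
    rw [hgeom, eq_sub_iff_add_eq, ← add_div, div_eq_iff hne]; ring
  have hN : ‖(1 - ζ) * (b * (m - S)) / (1 + m * b)‖ ≤ ‖1 - ζ‖ ^ 2 / 2 := by
    rw [norm_div, norm_mul, norm_mul, div_le_iff₀ hpos]
    have h1 := norm_geom_sum_sub_le hζ.le m
    have h2 : ‖b‖ * ‖(m : ℂ) - S‖ ≤ ‖b‖ * (m * (m - 1) / 2 * ‖1 - ζ‖) := by gcongr
    have h3 : ‖b‖ * (m * (m - 1)) ≤ ‖1 + m * b‖ := by nlinarith
    calc ‖1 - ζ‖ * (‖b‖ * ‖(m : ℂ) - S‖)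
        ≤ ‖1 - ζ‖ * (‖b‖ * (m * (m - 1) / 2 * ‖1 - ζ‖)) := by gcongr
      _ = ‖1 - ζ‖ ^ 2 / 2 * (‖b‖ * (m * (m - 1))) := by ring
      _ ≤ _ := by gcongr
  have h4 := (Complex.re_le_norm _).trans hN
  have h5 : ‖1 - ζ‖ ^ 2 = 1 - 2 * ζ.re + ‖ζ‖ ^ 2 := by
    rw [← Complex.normSq_eq_norm_sq, ← Complex.normSq_eq_norm_sq, Complex.normSq_apply,
      Complex.normSq_apply]
    simp; ring
  rw [hkey, Complex.sub_re, Complex.sub_re, Complex.one_re]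
  nlinarith [norm_nonneg ζ]

/-- The image of the disk under `φ z = z + a z ^ (n + 1)` lies strictly on one side of the tangent
line at the boundary point `φ w`, whose normal direction is `w φ' w`. -/
lemma re_div_pos {a w z : ℂ} {n : ℕ} (hn : 1 ≤ n) (ha : ((n : ℝ) + 1) ^ 2 * ‖a‖ ≤ 1)
    (hw : ‖w‖ = 1) (hz : ‖z‖ < 1) :
    0 < ((w + a * w ^ (n + 1) - (z + a * z ^ (n + 1))) / (w * (1 + (n + 1) * a * w ^ n))).re := by
  have hw0 : w ≠ 0 := by
    rintro rfl
    simp at hw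
  have h := re_div_pos_of_one (b := a * w ^ n) (ζ := z / w) (m := n + 1) (by omega)
    (by rw [norm_mul, norm_pow, hw]; simpa using ha) (by rw [norm_div, hw]; simpa using hz)
  convert h using 2
  rw [show w + a * w ^ (n + 1) - (z + a * z ^ (n + 1)) =
    w * (1 - z / w + a * w ^ n * (1 - (z / w) ^ (n + 1))) by
      rw [div_pow]; field_simp; ring,
    mul_div_mul_left _ _ hw0]
  push_cast
  ring_nf

lemma polyMap_injOn {a : ℂ} {n : ℕ} (hn : 1 ≤ n) (ha : ((n : ℝ) + 1) ^ 2 * ‖a‖ ≤ 1) :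
    Set.InjOn (fun z : ℂ => z + a * z ^ (n + 1)) (ball 0 1) := by
  intro z hz w hw h
  by_contra hne
  have hpos : 0 < ‖z - w‖ := norm_pos_iff.2 (sub_ne_zero.2 hne)
  have h1 : z - w = -(a * (z ^ (n + 1) - w ^ (n + 1))) := by
    have : z + a * z ^ (n + 1) = w + a * w ^ (n + 1) := h
    linear_combination this
  have h2 := norm_pow_sub_pow_le (z := z) (w := w) (by simpa using (mem_ball.1 hz).le)
    (by simpa using (mem_ball.1 hw).le) (n + 1)
  have h3 : ‖z - w‖ ≤ ‖a‖ * (((n + 1 : ℕ) : ℝ) * ‖z - w‖) := by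
    calc ‖z - w‖ = ‖a‖ * ‖z ^ (n + 1) - w ^ (n + 1)‖ := by
          conv_lhs => rw [h1]
          rw [norm_neg, norm_mul]
      _ ≤ _ := by gcongr
  push_cast at h3
  have hn' : (1 : ℝ) ≤ n := by exact_mod_cast hn
  have h4 : ‖a‖ * (n + 1) ≤ 1 / 2 := by nlinarith [norm_nonneg a]
  nlinarith

lemma polyMap_hasStrictDerivAt (a : ℂ) (n : ℕ) (z : ℂ) :
    HasStrictDerivAt (fun z : ℂ => z + a * z ^ (n + 1)) (1 + (n + 1) * a * z ^ n) z := by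
  refine ((hasStrictDerivAt_id z).add ((hasStrictDerivAt_pow (n + 1) z).const_mul a)).congr_deriv ?_
  push_cast
  ring

lemma polyMap_deriv_ne_zero {a : ℂ} {n : ℕ} (hn : 1 ≤ n) (ha : ((n : ℝ) + 1) ^ 2 * ‖a‖ ≤ 1)
    {z : ℂ} (hz : ‖z‖ ≤ 1) : 1 + (n + 1) * a * z ^ n ≠ 0 := by
  intro h
  have hn' : (1 : ℝ) ≤ n := by exact_mod_cast hn
  have h1 : (n + 1) * a * z ^ n = -1 := by linear_combination h
  have h2 := congrArg norm h1
  have h3 : ‖(n : ℂ) + 1‖ = n + 1 := by exact_mod_cast Complex.norm_natCast (n + 1)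
  rw [norm_mul, norm_mul, norm_pow, h3, norm_neg, norm_one] at h2
  have h4 : ‖z‖ ^ n ≤ 1 := pow_le_one₀ (norm_nonneg _) hz
  have h5 : (n + 1) * ‖a‖ ≤ 1 / 2 := by nlinarith [norm_nonneg a]
  nlinarith [norm_nonneg a, pow_nonneg (norm_nonneg z) n]

/-- If a convex combination `x` of two points of the image were outside, the segment from `0` to `x`
would meet the boundary in some `b = φ w`, and the supporting line there, which has `0` and both
points strictly on one side, would have `x` on the other. -/
lemma polyMap_image_convex {a : ℂ} {n : ℕ} (hn : 1 ≤ n) (ha : ((n : ℝ) + 1) ^ 2 * ‖a‖ ≤ 1) :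
    Convex ℝ ((fun z : ℂ => z + a * z ^ (n + 1)) '' ball 0 1) := by
  set φ : ℂ → ℂ := fun z => z + a * z ^ (n + 1) with hφ
  have hφc : Continuous φ := by fun_prop
  have hopen : IsOpen (φ '' ball 0 1) := by
    rw [isOpen_iff_mem_nhds]
    rintro _ ⟨z, hz, rfl⟩
    rw [← (polyMap_hasStrictDerivAt a n z).map_nhds_eq
      (polyMap_deriv_ne_zero hn ha (by simpa using (mem_ball.1 hz).le))]
    exact Filter.image_mem_map (isOpen_ball.mem_nhds hz)
  rintro _ ⟨p, hp, rfl⟩ _ ⟨q, hq, rfl⟩ s t hs ht hst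
  set x := s • φ p + t • φ q with hx
  by_contra hxn
  have h0 : (0 : ℂ) ∈ φ '' ball 0 1 := ⟨0, by simp, by simp [hφ]⟩
  obtain ⟨b, ⟨hbc, hb⟩, hbn⟩ : ∃ b ∈ closure (φ '' ball 0 1) ∩ segment ℝ 0 x,
      b ∉ φ '' ball 0 1 := by
    by_contra! hcon
    exact hxn ((convex_segment 0 x).isPreconnected.subset_of_closure_inter_subset hopen
      ⟨0, left_mem_segment ℝ 0 x, h0⟩ hcon (right_mem_segment ℝ 0 x))
  have hcl : closure (φ '' ball 0 1) ⊆ φ '' closedBall 0 1 :=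
    closure_minimal (Set.image_mono ball_subset_closedBall)
      ((isCompact_closedBall _ _).image hφc).isClosed
  obtain ⟨w, hw, hwb⟩ := hcl hbc
  have hw1 : ‖w‖ = 1 := by
    refine le_antisymm (by simpa using hw) ?_
    by_contra! h
    exact hbn ⟨w, by simpa using h, hwb⟩
  set N := w * (1 + (n + 1) * a * w ^ n) with hN
  have hsupp : ∀ z, ‖z‖ < 1 → (φ z / N).re < (b / N).re := by
    intro z hz
    have := re_div_pos hn ha hw1 hz
    rw [sub_div, Complex.sub_re] at this
    rw [← hwb]
    exact sub_pos.1 this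
  have hp' := hsupp p (by simpa using hp)
  have hq' := hsupp q (by simpa using hq)
  have h0' : 0 < (b / N).re := by simpa [hφ] using hsupp 0 (by simp)
  have hx' : (x / N).re = s * (φ p / N).re + t * (φ q / N).re := by
    rw [hx, add_div, Complex.add_re, Complex.real_smul, Complex.real_smul, mul_div_assoc,
      mul_div_assoc, Complex.re_ofReal_mul, Complex.re_ofReal_mul]
  have hxlt : (x / N).re < (b / N).re := by
    rw [hx']
    rcases hs.eq_or_lt with rfl | hs'
    · simp at hst
      subst hst
      simpa using hq'
    · nlinarith
  rw [segment_eq_image] at hb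
  obtain ⟨u, hu, hub⟩ := hb
  have hb' : (b / N).re = u * (x / N).re := by
    rw [← hub]
    simp only [smul_zero, zero_add]
    rw [Complex.real_smul, mul_div_assoc, Complex.re_ofReal_mul]
  have hu0 := hu.1
  have hu1 := hu.2
  have hxpos : 0 < (x / N).re := by
    by_contra! h
    nlinarith
  nlinarith

/-! ### Injectivity criteria -/

/-- The **Noshiro–Warschawski** criterion. -/
lemma Convex.injOn_of_re_deriv_pos {V : Set ℂ} (hV : Convex ℝ V) {G G' : ℂ → ℂ}
    (hG : ∀ w ∈ V, HasDerivAt G (G' w) w) (hre : ∀ w ∈ V, 0 < (G' w).re) : Set.InjOn G V := by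
  intro p hp q hq h
  by_contra hne
  set v := q - p with hv
  have hv0 : v ≠ 0 := sub_ne_zero.2 (Ne.symm hne)
  have hmem : ∀ t ∈ Set.Icc (0 : ℝ) 1, p + t * v ∈ V := fun t ht => by
    simpa [hv] using hV.add_smul_sub_mem hp hq ht
  have hd : ∀ t ∈ Set.Icc (0 : ℝ) 1, HasDerivAt (fun t : ℝ => (G (p + t * v) / v).re)
      (G' (p + t * v)).re t := by
    intro t ht
    have hc : HasDerivAt (fun t : ℝ => p + (t : ℂ) * v) v t := by
      simpa using ((Complex.ofRealCLM.hasDerivAt (x := t)).mul_const v).const_add p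
    have h1 := ((hG _ (hmem t ht)).comp t hc).div_const v
    rw [mul_div_cancel_right₀ _ hv0] at h1
    exact Complex.reCLM.hasFDerivAt.comp_hasDerivAt t h1
  have hmono : StrictMonoOn (fun t : ℝ => (G (p + t * v) / v).re) (Set.Icc 0 1) := by
    refine strictMonoOn_of_deriv_pos (convex_Icc 0 1)
      (fun t ht => (hd t ht).continuousAt.continuousWithinAt) fun t ht => ?_
    rw [(hd t (interior_subset ht)).deriv]
    exact hre _ (hmem t (interior_subset ht))
  have := hmono (Set.left_mem_Icc.2 zero_le_one) (Set.right_mem_Icc.2 zero_le_one) zero_lt_one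
  simp [hv, h] at this

/-- A function `F` with `Re (F' / φ') > 0`, where `φ` is injective with convex image, is injective:
`F ∘ φ⁻¹` has derivative `F' / φ'`. -/
lemma injOn_of_re_deriv_div_pos {U : Set ℂ} (hU : IsOpen U) {φ φ' F p : ℂ → ℂ}
    (hφ : ∀ z ∈ U, HasStrictDerivAt φ (φ' z) z) (hφ0 : ∀ z ∈ U, φ' z ≠ 0)
    (hinj : Set.InjOn φ U) (hconv : Convex ℝ (φ '' U))
    (hF : ∀ z ∈ U, HasDerivAt F (p z * φ' z) z) (hre : ∀ z ∈ U, 0 < (p z).re) :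
    Set.InjOn F U := by
  set ψ := Function.invFunOn φ U with hψ
  have hl : ∀ z ∈ U, ψ (φ z) = z := fun z hz => hinj.leftInvOn_invFunOn hz
  have hG : Set.InjOn (F ∘ ψ) (φ '' U) := by
    refine hconv.injOn_of_re_deriv_pos (G' := p ∘ ψ) ?_ ?_
    · rintro _ ⟨z, hz, rfl⟩
      have h1 : HasDerivAt ψ (φ' z)⁻¹ (φ z) :=
        ((hφ z hz).to_local_left_inverse (hφ0 z hz)
          (Filter.mem_of_superset (hU.mem_nhds hz) hl)).hasDerivAt
      have h2 : HasDerivAt F (p z * φ' z) (ψ (φ z)) := by rw [hl z hz]; exact hF z hz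
      refine (h2.comp (φ z) h1).congr_deriv ?_
      rw [Function.comp_apply, hl z hz, mul_assoc, mul_inv_cancel₀ (hφ0 z hz), mul_one]
    · rintro _ ⟨z, hz, rfl⟩
      simpa [hl z hz] using hre z hz
  intro z hz w hw h
  refine hinj hz hw (hG ⟨z, hz, rfl⟩ ⟨w, hw, rfl⟩ ?_)
  simpa [hl z hz, hl w hw] using h

lemma exists_norm_eq_one_add_mul_eq_zero {A B : ℂ} (h : ‖A‖ = ‖B‖) :
    ∃ ε : ℂ, ‖ε‖ = 1 ∧ A + ε * B = 0 := by
  by_cases hB : B = 0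
  · exact ⟨1, by simp, by simpa [hB] using h⟩
  · refine ⟨-A / B, ?_, ?_⟩
    · rw [norm_div, norm_neg, h, div_self (norm_ne_zero_iff.2 hB)]
    · field_simp; ring

/-- A harmonic map `h + conj g` with `Re h' > 0` and dilatation `g' / h' = lam z ^ n`,
`‖lam‖ ≤ 1 / (n + 1)`, is injective, since every `h + ε g` with `‖ε‖ = 1` is close-to-convex. -/
lemma injOn_add_conj_of_dilatation_eq {n : ℕ} (hn : 1 ≤ n) {lam : ℂ}
    (hlam : ‖lam‖ ≤ 1 / ((n : ℝ) + 1)) {f h g p : ℂ → ℂ}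
    (hf : ∀ z ∈ ball (0 : ℂ) 1, f z = h z + (starRingEnd ℂ) (g z))
    (hh : ∀ z ∈ ball (0 : ℂ) 1, HasDerivAt h (p z) z)
    (hg : ∀ z ∈ ball (0 : ℂ) 1, HasDerivAt g (lam * z ^ n * p z) z)
    (hre : ∀ z ∈ ball (0 : ℂ) 1, 0 < (p z).re) : Set.InjOn f (ball 0 1) := by
  intro z hz w hw hzw
  rw [hf z hz, hf w hw] at hzw
  have hnorm : ‖h z - h w‖ = ‖g z - g w‖ := by
    rw [show h z - h w = -(starRingEnd ℂ) (g z - g w) by rw [map_sub]; linear_combination hzw,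
      norm_neg, RCLike.norm_conj]
  obtain ⟨ε, hε, hε0⟩ := exists_norm_eq_one_add_mul_eq_zero hnorm
  have hn0 : (0 : ℝ) < n + 1 := by positivity
  have hn0' : (n : ℂ) + 1 ≠ 0 := by exact_mod_cast n.succ_ne_zero
  set a : ℂ := ε * lam / (n + 1) with ha
  have hna : ((n : ℝ) + 1) ^ 2 * ‖a‖ ≤ 1 := by
    have h3 : ‖(n : ℂ) + 1‖ = n + 1 := by exact_mod_cast Complex.norm_natCast (n + 1)
    rw [ha, norm_div, norm_mul, hε, one_mul, h3]
    rw [le_div_iff₀ hn0] at hlam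
    calc ((n : ℝ) + 1) ^ 2 * (‖lam‖ / (n + 1)) = ‖lam‖ * (n + 1) := by field_simp
      _ ≤ 1 := hlam
  have hinj : Set.InjOn (fun z => h z + ε * g z) (ball 0 1) := by
    refine injOn_of_re_deriv_div_pos isOpen_ball (p := p)
      (fun z _ => polyMap_hasStrictDerivAt a n z)
      (fun z hz => polyMap_deriv_ne_zero hn hna (by simpa using (mem_ball.1 hz).le))
      (polyMap_injOn hn hna) (polyMap_image_convex hn hna) (fun z hz => ?_) hre
    refine ((hh z hz).add ((hg z hz).const_mul ε)).congr_deriv ?_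
    rw [ha]
    field_simp
  exact hinj hz hw (by linear_combination hε0)

/-! ### Area of the image of a disk -/

lemma det_eq_of_apply_eq_mul_add_conj_mul (a b : ℂ) (L : ℂ →L[ℝ] ℂ)
    (hL : ∀ v, L v = a * v + (starRingEnd ℂ) (b * v)) : L.det = ‖a‖ ^ 2 - ‖b‖ ^ 2 := by
  rw [ContinuousLinearMap.det, ← LinearMap.det_toMatrix Complex.basisOneI, Matrix.det_fin_two]
  simp only [LinearMap.toMatrix_apply, ContinuousLinearMap.coe_coe, hL]
  rw [← Complex.normSq_eq_norm_sq, ← Complex.normSq_eq_norm_sq, Complex.normSq_apply,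
      Complex.normSq_apply]
  simp
  ring

/-- Integration of a radial function over a disk, in polar coordinates. -/
lemma setLIntegral_ball_norm {r : ℝ} (hr : 0 < r) {G : ℝ → ℝ} (hG : Continuous G)
    (hpos : ∀ t ∈ Set.Ico 0 r, 0 ≤ G t) :
    ∫⁻ z in ball (0 : ℂ) r, ENNReal.ofReal (G ‖z‖) =
      ENNReal.ofReal (2 * Real.pi * ∫ t in (0 : ℝ)..r, G t * t) := by
  have hint : IntegrableOn (fun z : ℂ => G ‖z‖) (ball 0 r) :=
    ((hG.comp continuous_norm).continuousOn.integrableOn_compact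
      (isCompact_closedBall (0 : ℂ) r)).mono_set ball_subset_closedBall
  rw [← ofReal_integral_eq_lintegral_ofReal hint]
  · congr 1
    have h1 : ∀ z : ℂ, (ball (0 : ℂ) r).indicator (fun z => G ‖z‖) z =
        (Set.Iio r).indicator G ‖z‖ := fun z => by
      simp only [Set.indicator, mem_ball, dist_zero_right, Set.mem_Iio]
    rw [← integral_indicator measurableSet_ball]
    simp_rw [h1]
    rw [integral_fun_norm_addHaar volume ((Set.Iio r).indicator G), Complex.finrank_real_complex]
    have h2 : (volume : Measure ℂ).real (ball 0 1) = Real.pi := by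
      simp [Measure.real, Complex.volume_ball]
    have h3 : ∫ y in Set.Ioi (0 : ℝ), y ^ (2 - 1) • (Set.Iio r).indicator G y =
        ∫ t in (0 : ℝ)..r, G t * t := by
      have h4 : ∀ y : ℝ, y ^ (2 - 1) • (Set.Iio r).indicator G y =
          (Set.Iio r).indicator (fun t => G t * t) y := fun y => by
        simp only [Set.indicator]
        split_ifs <;> simp [mul_comm]
      simp_rw [h4]
      rw [setIntegral_indicator measurableSet_Iio, Set.Ioi_inter_Iio,
        intervalIntegral.integral_of_le hr.le, integral_Ioc_eq_integral_Ioo]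
    rw [h2, h3]
    simp
    ring
  · exact (ae_restrict_iff' measurableSet_ball).2 (Filter.Eventually.of_forall fun z hz =>
      hpos _ ⟨norm_nonneg _, by simpa using hz⟩)

lemma volume_image_add_conj {f h g h' g' : ℂ → ℂ} {r : ℝ}
    (hf : ∀ z ∈ ball (0 : ℂ) r, f z = h z + (starRingEnd ℂ) (g z))
    (hh : ∀ z ∈ ball (0 : ℂ) r, HasDerivAt h (h' z) z)
    (hg : ∀ z ∈ ball (0 : ℂ) r, HasDerivAt g (g' z) z)
    (hinj : Set.InjOn f (ball 0 r)) :
    volume (f '' ball (0 : ℂ) r) =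
      ∫⁻ z in ball (0 : ℂ) r, ENNReal.ofReal |‖h' z‖ ^ 2 - ‖g' z‖ ^ 2| := by
  set L : ℂ → ℂ →L[ℝ] ℂ := fun z =>
    (ContinuousLinearMap.toSpanSingleton ℂ (h' z)).restrictScalars ℝ +
      (Complex.conjCLE : ℂ →L[ℝ] ℂ).comp
        ((ContinuousLinearMap.toSpanSingleton ℂ (g' z)).restrictScalars ℝ) with hL
  have hd : ∀ z ∈ ball (0 : ℂ) r, HasFDerivWithinAt f (L z) (ball 0 r) z := by
    intro z hz
    have h1 : HasFDerivAt (fun z => h z + (starRingEnd ℂ) (g z)) (L z) z :=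
      ((hh z hz).hasFDerivAt.restrictScalars ℝ).add
        ((Complex.conjCLE : ℂ →L[ℝ] ℂ).hasFDerivAt.comp z
          ((hg z hz).hasFDerivAt.restrictScalars ℝ))
    exact h1.hasFDerivWithinAt.congr hf (hf z hz)
  rw [← lintegral_abs_det_fderiv_eq_addHaar_image volume measurableSet_ball hd hinj]
  refine lintegral_congr fun z => ?_
  rw [det_eq_of_apply_eq_mul_add_conj_mul (h' z) (g' z) (L z) fun v => by simp [hL, mul_comm]]

theorem theorem3 (α : ℝ) (hα₁ : 1 < α) (hα₂ : α ≤ 3 / 2) (n : ℕ) (hn : 1 ≤ n)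
    (lam : ℂ) (hlam : ‖lam‖ ≤ 1 / ((n : ℝ) + 1))
    (f : ℂ → ℂ) (hf : f ∈ harmonicClassF α lam n)
    (r : ℝ) (hr₀ : 0 < r) (hr₁ : r < 1) :
    ENNReal.ofReal (2 * Real.pi *
        ∫ ξ in (0 : ℝ)..r, (1 - ‖lam‖ ^ 2 * ξ ^ (2 * n)) * (1 - ξ) ^ 2 * ξ)
      ≤ volume (f '' ball (0 : ℂ) r) ∧
    volume (f '' ball (0 : ℂ) r)
      ≤ ENNReal.ofReal (2 * Real.pi *
        ∫ ξ in (0 : ℝ)..r, (1 - ‖lam‖ ^ 2 * ξ ^ (2 * n)) * (1 + ξ) ^ 2 * ξ) := by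
  obtain ⟨h, g, hnorm, hpre, hgder⟩ := hf
  have hsub : ball (0 : ℂ) r ⊆ ball 0 1 := ball_subset_ball hr₁.le
  have hh : ∀ z ∈ ball (0 : ℂ) 1, HasDerivAt h (deriv h z) z := fun z hz =>
    (hnorm.analytic_h z hz).differentiableAt.hasDerivAt
  have hg : ∀ z ∈ ball (0 : ℂ) 1, HasDerivAt g (lam * z ^ n * deriv h z) z := fun z hz => by
    rw [← hgder z hz]
    exact (hnorm.analytic_g z hz).differentiableAt.hasDerivAt
  have hbound : ∀ z ∈ ball (0 : ℂ) 1, ‖deriv h z - 1‖ ≤ ‖z‖ := by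
    refine norm_sub_one_le hnorm.analytic_h.deriv.differentiableOn hnorm.deriv_h_zero
      (fun z hz => (hpre z hz).1) fun z hz => ?_
    have := (hpre z hz).2
    rw [Complex.add_re, Complex.one_re] at this
    linarith
  have hre : ∀ z ∈ ball (0 : ℂ) 1, 0 < (deriv h z).re := fun z hz => by
    have h1 := (Complex.abs_re_le_norm (deriv h z - 1)).trans (hbound z hz)
    have h2 : ‖z‖ < 1 := by simpa using hz
    rw [Complex.sub_re, Complex.one_re] at h1
    linarith [(abs_le.1 h1).1]
  have hinj := injOn_add_conj_of_dilatation_eq hn hlam hnorm.eq_add_conj hh hg hre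
  rw [volume_image_add_conj (fun z hz => hnorm.eq_add_conj z (hsub hz))
    (fun z hz => hh z (hsub hz)) (fun z hz => hg z (hsub hz)) (hinj.mono hsub)]
  have hlam1 : ‖lam‖ ≤ 1 := hlam.trans (by
    rw [div_le_one (by positivity)]
    linarith [(Nat.cast_nonneg n : (0 : ℝ) ≤ n)])
  have hfac : ∀ t ∈ Set.Ico (0 : ℝ) r, 0 ≤ 1 - ‖lam‖ ^ 2 * t ^ (2 * n) := fun t ht => by
    have h1 : ‖lam‖ ^ 2 ≤ 1 := pow_le_one₀ (norm_nonneg _) hlam1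
    have h2 : t ^ (2 * n) ≤ 1 := pow_le_one₀ ht.1 (ht.2.trans hr₁).le
    have := mul_le_one₀ h1 (pow_nonneg ht.1 _) h2
    linarith
  have hjac : ∀ z ∈ ball (0 : ℂ) r,
      |‖deriv h z‖ ^ 2 - ‖lam * z ^ n * deriv h z‖ ^ 2| =
        (1 - ‖lam‖ ^ 2 * ‖z‖ ^ (2 * n)) * ‖deriv h z‖ ^ 2 := fun z hz => by
    rw [← abs_of_nonneg (mul_nonneg (hfac ‖z‖ ⟨norm_nonneg _, by simpa using hz⟩)
      (sq_nonneg ‖deriv h z‖)), norm_mul, norm_mul, norm_pow]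
    congr 1
    ring
  have hnb : ∀ z ∈ ball (0 : ℂ) r, 1 - ‖z‖ ≤ ‖deriv h z‖ ∧ ‖deriv h z‖ ≤ 1 + ‖z‖ := fun z hz => by
    have h1 := hbound z (hsub hz)
    have h2 := norm_sub_norm_le (1 : ℂ) (deriv h z)
    have h3 := norm_sub_norm_le (deriv h z) 1
    rw [norm_sub_rev] at h2
    rw [norm_one] at h2 h3
    constructor <;> linarith
  rw [← setLIntegral_ball_norm hr₀ (by fun_prop)
      fun t ht => mul_nonneg (hfac t ht) (sq_nonneg (1 - t)),
    ← setLIntegral_ball_norm hr₀ (by fun_prop)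
      fun t ht => mul_nonneg (hfac t ht) (sq_nonneg (1 + t))]
  constructor
  · refine setLIntegral_mono' measurableSet_ball fun z hz => ENNReal.ofReal_le_ofReal ?_
    have hz1 : ‖z‖ < r := by simpa using hz
    rw [hjac z hz]
    exact mul_le_mul_of_nonneg_left (pow_le_pow_left₀ (by linarith) (hnb z hz).1 2)
      (hfac _ ⟨norm_nonneg _, hz1⟩)
  · refine setLIntegral_mono' measurableSet_ball fun z hz => ENNReal.ofReal_le_ofReal ?_
    have hz1 : ‖z‖ < r := by simpa using hz
    rw [hjac z hz]
    exact mul_le_mul_of_nonneg_left (pow_le_pow_left₀ (norm_nonneg _) (hnb z hz).2 2)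
      (hfac _ ⟨norm_nonneg _, hz1⟩)
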